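/- Let $\mathbb{K}$ be a field and let $S=\mathbb{K}[x_1,\dots,x_n]$ with its standard $\mathbb{Z}^n$-grading. For a finitely generated $\mathbb{Z}^n$-graded $S$-module $M$, a homogeneous element $u\in M$ and $Z\subseteq\{x_1,\dots,x_n\}$, the $\mathbb{K}$-subspace $u\mathbb{K}[Z]=\{uf : f\in\mathbb{K}[Z]\}$ of $M$ is called a Stanley space of dimension $|Z|$ if it is a free $\mathbb{K}[Z]$-module with basis $u$. A Stanley decomposition of $M$ is a decomposition of $M$ as a finite direct sum of Stanley spaces. For $M\neq 0$, the Stanley depth $\mathrm{sdepth}(M)$ is the maximum, over all Stanley decompositions $\mathcal{D}$ of $M$, of the minimum dimension of a Stanley space in $\mathcal{D}$. Over the polynomial ring $S'$ in a subset of the variables, the Stanley depth is defined in the same way and denoted by $\mathrm{sdepth}_{S'}$. Let $G$ be a finite simple graph with vertex set $\{v_1,\dots,v_n\}$. Its edge ideal $I(G)$ is the ideal of $S$ generated by all $x_ix_j$ such that $\{v_i,v_j\}$ is an edge of $G$; the edge ideal of a subgraph is taken in the polynomial ring in the variables of the vertices of that subgraph. **Theorem.** Let $H$ be a connected component of $G$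 with at least one edge, and let $h$ be the number of bipartite connected components of the graph $G\setminus V(H)$ obtained from $G$ by removing the vertices of $H$ (an isolated vertex counts as a bipartite component). Then for every integer $k\geq 1$, $$\mathrm{sdepth}(I(G)^k)\ \geq\ \min_{1\leq l\leq k}\mathrm{sdepth}_{S'}(I(H)^l)+h,$$ where $S'=\mathbb{K}[x_i\mid v_i\in V(H)]$. -/

import Mathlib

namespace StanleyDepth

open MvPolynomial

/-- The Stanley space `u K[Z]`: the `K`-subspace of the module `M` over `S = K[x_i | i ∈ σ]`
consisting of all elements `f • u` with `f ∈ K[Z]`, where `Z` is a set of variables and `K[Z]` is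
viewed as a subring of `S`. -/
noncomputable def stanleySpace {σ K M : Type*} [Field K] [AddCommGroup M] [Module K M]
    [Module (MvPolynomial σ K) M] [IsScalarTower K (MvPolynomial σ K) M]
    (u : M) (Z : Finset σ) : Submodule K M :=
  (Subalgebra.toSubmodule (supported K (Z : Set σ))).map
    ((LinearMap.toSpanSingleton (MvPolynomial σ K) M u).restrictScalars K)

/-- `M = ⨁ i, u i K[Z i]` is a (finite) Stanley decomposition of the `ℤ^σ`-graded module `M` over
`S = K[x_i | i ∈ σ]`, the component of `M` of degree `a` being `ℳ a`. -/
structure IsStanleyDecomposition {σ K M : Type*} [Field K] [AddCommGroup M] [Module K M]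
    [Module (MvPolynomial σ K) M] [IsScalarTower K (MvPolynomial σ K) M]
    (ℳ : (σ →₀ ℤ) → Submodule K M) {r : ℕ} (u : Fin r → M) (Z : Fin r → Finset σ) : Prop where
  /-- every generator is a homogeneous element of `M` -/
  homogeneous : ∀ i, ∃ a, u i ∈ ℳ a
  /-- `u i K[Z i]` is a free `K[Z i]`-module with basis `u i` -/
  free : ∀ i, ∀ f ∈ supported K (Z i : Set σ), f • u i = 0 → f = 0
  /-- `M` is the direct sum of the Stanley spaces -/
  isInternal : DirectSum.IsInternal fun i => stanleySpace (K := K) (u i) (Z i)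

/-- The Stanley depth of the `ℤ^σ`-graded module `M` over `S = K[x_i | i ∈ σ]` with graded
components `ℳ a`: the largest value, over all Stanley decompositions, of the smallest dimension
`|Z i|` of a Stanley space in the decomposition. As usual, it is `⊤` for the zero module (which has
the empty decomposition); if `σ` is finite and `M ≠ 0`, the values are at most `|σ|`, so that the
supremum is a maximum. -/
noncomputable def sdepth {σ K M : Type*} [Field K] [AddCommGroup M] [Module K M]
    [Module (MvPolynomial σ K) M] [IsScalarTower K (MvPolynomial σ K) M]
    (ℳ : (σ →₀ ℤ) → Submodule K M) : ℕ∞ :=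
  ⨆ (r : ℕ) (u : Fin r → M) (Z : Fin r → Finset σ) (_ : IsStanleyDecomposition ℳ u Z),
    ⨅ i, ((Z i).card : ℕ∞)

/-- The component of multidegree `a ∈ ℤ^σ` of an ideal `I` of `S = K[x_i | i ∈ σ]`, where `S` has
the standard `ℤ^σ`-grading, in which `x_i` has degree the `i`-th unit vector. -/
noncomputable def idealComponent {σ K : Type*} [Field K] (I : Ideal (MvPolynomial σ K))
    (a : σ →₀ ℤ) : Submodule K I :=
  (weightedHomogeneousSubmodule K (fun i : σ => Finsupp.single i (1 : ℤ)) a).comap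
    ((Submodule.subtype I).restrictScalars K)

/-- The Stanley depth of an ideal of the polynomial ring (meant for monomial ideals), regarded as a
`ℤ^σ`-graded module over this ring. -/
noncomputable def idealSdepth {σ K : Type*} [Field K] (I : Ideal (MvPolynomial σ K)) : ℕ∞ :=
  sdepth (idealComponent I)

/-- The edge ideal of a graph, in the polynomial ring whose variables are the vertices. -/
noncomputable def edgeIdeal {V : Type*} (K : Type*) [Field K] (G : SimpleGraph V) :
    Ideal (MvPolynomial V K) :=
  Ideal.span {p | ∃ v w, G.Adj v w ∧ p = X v * X w}

/-- The number of bipartite connected components of a (finite) graph. An isolated vertex is a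
bipartite component. -/
noncomputable def numBipartiteComponents {V : Type*} (G : SimpleGraph V) : ℕ :=
  Set.ncard {D : G.ConnectedComponent | D.toSimpleGraph.IsBipartite}

end StanleyDepth

/-!
Monomials turn Stanley decompositions of a monomial ideal into partitions of its set of exponent
vectors into boxes `u + ℕ ^ Z`. A monomial lies in `I(G) ^ k` iff at least `k` edges can be packed
into its exponent vector, and the largest such `k`, the order, is additive over a splitting of `G`
into unions of components. So `I(G) ^ k` is the direct sum, over `i < k`, of
`(I ^ i / I ^ (i + 1)) ⊗ I(H) ^ (k - i)` and of `I ^ k ⊗ K[V(H)]`, where `I` is the edge ideal of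
the rest of `G`, and Stanley depths add up in each of these tensor products.

Splitting the rest of `G` into its components in the same way, it remains to see that all
`I ^ i / I ^ (i + 1)` and all `I ^ k` have positive Stanley depth if `I` is the edge ideal of a
bipartite graph. By Kőnig's theorem the order of `m` is then the minimum of `∑ v ∈ C, m v` over the
vertex covers `C`. It does not change when `m v` grows for a vertex `v` outside a minimizing `C`, so
every exponent vector has a free direction.
-/

namespace StanleyDepth

open MvPolynomial

open scoped Pointwise Function

section Support

variable {V : Type*} {A B : Set V} {a a' b b' : V →₀ ℕ}

lemma mem_supported_of_le (h : a ≤ b) (hb : b ∈ Finsupp.supported ℕ ℕ A) :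
    a ∈ Finsupp.supported ℕ ℕ A :=
  fun _ hv => hb (Finsupp.support_mono h hv)

lemma add_le_add_iff_of_mem_supported (hAB : Disjoint A B) (ha : a ∈ Finsupp.supported ℕ ℕ A)
    (ha' : a' ∈ Finsupp.supported ℕ ℕ A) (hb : b ∈ Finsupp.supported ℕ ℕ B)
    (hb' : b' ∈ Finsupp.supported ℕ ℕ B) : a + b ≤ a' + b' ↔ a ≤ a' ∧ b ≤ b' := by
  rw [Finsupp.mem_supported'] at ha ha' hb hb'
  refine ⟨fun h => ⟨fun v => ?_, fun v => ?_⟩, fun h => add_le_add h.1 h.2⟩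
  · by_cases hv : v ∈ A
    · have hvB := Set.disjoint_left.1 hAB hv
      simpa [hb v hvB, hb' v hvB] using h v
    · simp [ha v hv]
  · by_cases hv : v ∈ B
    · have hvA := Set.disjoint_right.1 hAB hv
      simpa [ha v hvA, ha' v hvA] using h v
    · simp [hb v hv]

lemma injOn_add_of_disjoint (hAB : Disjoint A B) :
    Set.InjOn (fun p : (V →₀ ℕ) × (V →₀ ℕ) => p.1 + p.2)
      ((Finsupp.supported ℕ ℕ A : Set (V →₀ ℕ)) ×ˢ (Finsupp.supported ℕ ℕ B)) := by
  rintro ⟨a, b⟩ ⟨ha, hb⟩ ⟨a', b'⟩ ⟨ha', hb'⟩ (h : a + b = a' + b')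
  have h₁ := (add_le_add_iff_of_mem_supported hAB ha ha' hb hb').1 h.le
  have h₂ := (add_le_add_iff_of_mem_supported hAB ha' ha hb' hb).1 h.ge
  exact Prod.ext (h₁.1.antisymm h₂.1) (h₁.2.antisymm h₂.2)

lemma supported_union_eq_add (A B : Set V) :
    (Finsupp.supported ℕ ℕ (A ∪ B) : Set (V →₀ ℕ)) =
      (Finsupp.supported ℕ ℕ A : Set (V →₀ ℕ)) + (Finsupp.supported ℕ ℕ B : Set (V →₀ ℕ)) := by
  rw [Finsupp.supported_union, Submodule.coe_sup]

end Support

section Partition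

variable {V W ι κ : Type*}

/-- The exponent vectors of the monomials in the Stanley space `X ^ u * K[Z]`. -/
def box (u : V →₀ ℕ) (Z : Finset V) : Set (V →₀ ℕ) :=
  {u} + (Finsupp.supported ℕ ℕ (Z : Set V) : Set (V →₀ ℕ))

lemma mem_box_iff {u m : V →₀ ℕ} {Z : Finset V} :
    m ∈ box u Z ↔ u ≤ m ∧ ∀ v ∉ Z, m v = u v := by
  rw [box, Set.singleton_add, Set.mem_image]
  constructor
  · rintro ⟨a, ha, rfl⟩
    rw [SetLike.mem_coe, Finsupp.mem_supported'] at ha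
    exact ⟨le_self_add, fun v hv => by simp [ha v hv]⟩
  · rintro ⟨hum, h⟩
    refine ⟨m - u, ?_, add_tsub_cancel_of_le hum⟩
    rw [SetLike.mem_coe, Finsupp.mem_supported']
    exact fun v hv => by simp [h v hv]

lemma self_mem_box (u : V →₀ ℕ) (Z : Finset V) : u ∈ box u Z :=
  mem_box_iff.2 ⟨le_rfl, fun _ _ => rfl⟩

lemma add_single_mem_box (u : V →₀ ℕ) {Z : Finset V} {v : V} (hv : v ∈ Z) (t : ℕ) :
    u + Finsupp.single v t ∈ box u Z :=
  Set.add_mem_add rfl (Finsupp.single_mem_supported ℕ t hv)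

lemma box_add_box [DecidableEq V] (u u' : V →₀ ℕ) (Z Z' : Finset V) :
    box u Z + box u' Z' = box (u + u') (Z ∪ Z') := by
  rw [box, box, box, Finset.coe_union, supported_union_eq_add, ← Set.singleton_add_singleton,
    add_add_add_comm]

lemma image_mapDomain_box (f : V ↪ W) (u : V →₀ ℕ) (Z : Finset V) :
    Finsupp.mapDomain f '' box u Z = box (Finsupp.mapDomain f u) (Z.map f) := by
  have hZ := congrArg SetLike.coe (Finsupp.lmapDomain_supported ℕ ℕ f (Z : Set V))
  rw [Submodule.map_coe] at hZ
  rw [box, box, Finset.coe_map, ← hZ, ← Set.image_singleton (f := Finsupp.mapDomain f)]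
  exact Set.image_add (Finsupp.mapDomain.addMonoidHom f)

/-- A partition of a set of exponent vectors into boxes, the combinatorial counterpart of a Stanley
decomposition. -/
structure IsStanleyPartition (M : Set (V →₀ ℕ)) (u : ι → V →₀ ℕ) (Z : ι → Finset V) : Prop where
  iUnion_eq : ⋃ i, box (u i) (Z i) = M
  pairwise_disjoint : Pairwise (Disjoint on fun i => box (u i) (Z i))

/-- `M` can be partitioned into finitely many boxes of dimension at least `d`. -/
def HasStanleyPartition (M : Set (V →₀ ℕ)) (d : ℕ) : Prop :=
  ∃ (r : ℕ) (u : Fin r → V →₀ ℕ) (Z : Fin r → Finset V),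
    IsStanleyPartition M u Z ∧ ∀ i, d ≤ (Z i).card

variable {M N : Set (V →₀ ℕ)} {d e : ℕ}

lemma IsStanleyPartition.subset {u : ι → V →₀ ℕ} {Z : ι → Finset V}
    (h : IsStanleyPartition M u Z) (i : ι) : box (u i) (Z i) ⊆ M :=
  h.iUnion_eq ▸ Set.subset_iUnion (fun i => box (u i) (Z i)) i

lemma IsStanleyPartition.hasStanleyPartition [Finite ι] {u : ι → V →₀ ℕ} {Z : ι → Finset V}
    (h : IsStanleyPartition M u Z) (hd : ∀ i, d ≤ (Z i).card) : HasStanleyPartition M d := by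
  obtain ⟨r, ⟨f⟩⟩ := Finite.exists_equiv_fin ι
  refine ⟨r, u ∘ f.symm, Z ∘ f.symm, ⟨?_, fun i j hij => ?_⟩, fun i => hd _⟩
  · rw [← h.iUnion_eq]
    exact f.symm.surjective.iUnion_comp fun i => box (u i) (Z i)
  · exact h.pairwise_disjoint (f.symm.injective.ne hij)

lemma HasStanleyPartition.mono (h : HasStanleyPartition M d) (hed : e ≤ d) :
    HasStanleyPartition M e := by
  obtain ⟨r, u, Z, h, hd⟩ := h
  exact ⟨r, u, Z, h, fun i => hed.trans (hd i)⟩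

lemma HasStanleyPartition.iUnion [Finite κ] {M : κ → Set (V →₀ ℕ)}
    (h : ∀ j, HasStanleyPartition (M j) d) (hM : Pairwise (Disjoint on M)) :
    HasStanleyPartition (⋃ j, M j) d := by
  choose r u Z h hd using h
  refine IsStanleyPartition.hasStanleyPartition (ι := Σ j, Fin (r j)) (u := fun i => u i.1 i.2)
    (Z := fun i => Z i.1 i.2) ⟨?_, ?_⟩ fun i => hd i.1 i.2
  · simp only [Set.iUnion_sigma, (h _).iUnion_eq]
  · rintro ⟨j, i⟩ ⟨j', i'⟩ hne
    rcases eq_or_ne j j' with rfl | hj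
    · exact (h j).pairwise_disjoint fun hi => hne (congrArg (Sigma.mk j) hi)
    · exact (hM hj).mono ((h j).subset i) ((h j').subset i')

lemma HasStanleyPartition.add (h : HasStanleyPartition M d) (h' : HasStanleyPartition N e)
    (hMN : Set.InjOn (fun p : (V →₀ ℕ) × (V →₀ ℕ) => p.1 + p.2) (M ×ˢ N)) :
    HasStanleyPartition (M + N) (d + e) := by
  classical
  obtain ⟨r, u, Z, h, hd⟩ := h
  obtain ⟨r', u', Z', h', he⟩ := h'
  have hZ (i j) : Disjoint (Z i) (Z' j) := by
    refine Finset.disjoint_left.2 fun v hv hv' => ?_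
    have hp : (u i + Finsupp.single v 1, u' j) ∈ M ×ˢ N :=
      ⟨h.subset i (add_single_mem_box _ hv 1), h'.subset j (self_mem_box _ _)⟩
    have hq : (u i, u' j + Finsupp.single v 1) ∈ M ×ˢ N :=
      ⟨h.subset i (self_mem_box _ _), h'.subset j (add_single_mem_box _ hv' 1)⟩
    simpa using congrArg Prod.fst (hMN hp hq (by simp only; abel))
  refine IsStanleyPartition.hasStanleyPartition (ι := Fin r × Fin r')
    (u := fun i => u i.1 + u' i.2) (Z := fun i => Z i.1 ∪ Z' i.2) ⟨?_, ?_⟩ fun i => ?_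
  · simp only [← box_add_box, Set.iUnion_prod', ← Set.add_iUnion, ← Set.iUnion_add, h.iUnion_eq,
      h'.iUnion_eq]
  · refine fun i j hij => Set.disjoint_left.2 fun m hi hj => hij ?_
    simp only [← box_add_box] at hi hj
    obtain ⟨a, ha, b, hb, hab⟩ := hi
    obtain ⟨a', ha', b', hb', rfl⟩ := hj
    obtain ⟨rfl, rfl⟩ := Prod.mk.inj <| hMN (x₁ := (a, b)) (x₂ := (a', b'))
      ⟨h.subset _ ha, h'.subset _ hb⟩ ⟨h.subset _ ha', h'.subset _ hb'⟩ hab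
    exact Prod.ext (h.pairwise_disjoint.eq (Set.not_disjoint_iff.2 ⟨_, ha, ha'⟩))
      (h'.pairwise_disjoint.eq (Set.not_disjoint_iff.2 ⟨_, hb, hb'⟩))
  · rw [Finset.card_union_of_disjoint (hZ _ _)]
    exact add_le_add (hd _) (he _)

lemma HasStanleyPartition.image_mapDomain (h : HasStanleyPartition M d) (f : V ↪ W) :
    HasStanleyPartition (Finsupp.mapDomain f '' M) d := by
  obtain ⟨r, u, Z, h, hd⟩ := h
  refine ⟨r, fun i => Finsupp.mapDomain f (u i), fun i => (Z i).map f, ⟨?_, fun i j hij => ?_⟩,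
    fun i => by simpa only [Finset.card_map] using hd i⟩
  · simp only [← image_mapDomain_box, ← Set.image_iUnion, h.iUnion_eq]
  · simp only [Function.onFun, ← image_mapDomain_box]
    exact (Set.disjoint_image_iff (Finsupp.mapDomain_injective f.injective)).2
      (h.pairwise_disjoint hij)

lemma hasStanleyPartition_box (u : V →₀ ℕ) (Z : Finset V) : HasStanleyPartition (box u Z) Z.card :=
  IsStanleyPartition.hasStanleyPartition (ι := Unit) (u := fun _ => u) (Z := fun _ => Z)
    ⟨Set.iUnion_const _, Subsingleton.pairwise⟩ fun _ => le_rfl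

lemma hasStanleyPartition_supported (A : Set V) [Finite A] :
    HasStanleyPartition (Finsupp.supported ℕ ℕ A : Set (V →₀ ℕ)) (Nat.card A) := by
  simpa [box, Nat.card_coe_set_eq, Set.ncard_eq_toFinset_card A] using
    hasStanleyPartition_box 0 (Set.toFinite A).toFinset

end Partition

section OrdConnected

variable {V : Type*} {M : Set (V →₀ ℕ)}

/-- Dickson's lemma: an upper set is generated by finitely many elements, so membership in it only
depends on the truncation at any common upper bound of these. -/
lemma exists_forall_inf_mem_iff [Finite V] {U : Set (V →₀ ℕ)} (hU : IsUpperSet U) :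
    ∃ g, ∀ g' ≥ g, ∀ m, m ⊓ g' ∈ U ↔ m ∈ U := by
  have hfin : {m | Minimal (· ∈ U) m}.Finite :=
    WellQuasiOrderedLE.finite_of_isAntichain (setOfPred_minimal_antichain _)
  refine ⟨hfin.toFinset.sup id, fun g' hg' m => ⟨fun h => hU inf_le_left h, fun h => ?_⟩⟩
  obtain ⟨c, hcm, hc⟩ := exists_minimal_le_of_wellFoundedLT (· ∈ U) m h
  have hcg : c ≤ g' := (Finset.le_sup (f := id) (hfin.mem_toFinset.2 hc)).trans hg'
  exact hU (le_inf hcm hcg) hc.prop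

lemma exists_inf_mem_iff_of_ordConnected [Finite V] (hM : M.OrdConnected) :
    ∃ g, ∀ m, m ⊓ g ∈ M ↔ m ∈ M := by
  obtain ⟨g₁, h₁⟩ := exists_forall_inf_mem_iff (upperClosure M).upper
  obtain ⟨g₂, h₂⟩ := exists_forall_inf_mem_iff (lowerClosure M).lower.compl
  refine ⟨g₁ ⊔ g₂, fun m => ?_⟩
  rw [← hM.upperClosure_inter_lowerClosure]
  exact and_congr (h₁ _ le_sup_left m) (not_iff_not.1 (h₂ _ le_sup_right m))

lemma mem_box_filter_eq_iff_inf_eq [Fintype V] {c g m : V →₀ ℕ} (hc : c ≤ g) :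
    m ∈ box c {v | c v = g v} ↔ m ⊓ g = c := by
  have hc' (v : V) : c v ≤ g v := hc v
  rw [mem_box_iff, Finsupp.le_def, DFunLike.ext_iff, ← forall_and]
  refine forall_congr' fun v => ?_
  have := hc' v
  simp only [Finset.mem_filter_univ, Finsupp.inf_apply]
  omega

lemma hasStanleyPartition_zero_of_ordConnected [Finite V] (hM : M.OrdConnected) :
    HasStanleyPartition M 0 := by
  classical
  have := Fintype.ofFinite V
  obtain ⟨g, hg⟩ := exists_inf_mem_iff_of_ordConnected hM
  have : Finite {c // c ≤ g ∧ c ∈ M} :=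
    ((Set.finite_Iic g).subset fun c (hc : c ≤ g ∧ c ∈ M) => hc.1).to_subtype
  refine IsStanleyPartition.hasStanleyPartition (ι := {c // c ≤ g ∧ c ∈ M}) (u := Subtype.val)
    (Z := fun c => {v | c.1 v = g v}) ⟨?_, fun c c' hcc' => ?_⟩ fun _ => Nat.zero_le _
  · ext m
    simp only [Set.mem_iUnion]
    constructor
    · rintro ⟨⟨c, hcg, hcM⟩, hm⟩
      rw [mem_box_filter_eq_iff_inf_eq hcg] at hm
      exact (hg m).1 (hm ▸ hcM)
    · exact fun hm => ⟨⟨m ⊓ g, inf_le_right, (hg m).2 hm⟩,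
        (mem_box_filter_eq_iff_inf_eq inf_le_right).2 rfl⟩
  · refine Set.disjoint_left.2 fun m hm hm' => hcc' (Subtype.ext ?_)
    rw [← (mem_box_filter_eq_iff_inf_eq c.2.1).1 hm, (mem_box_filter_eq_iff_inf_eq c'.2.1).1 hm']

/-- The directions in which one can walk arbitrarily far from `m` without leaving `M`. -/
def rays (M : Set (V →₀ ℕ)) (m : V →₀ ℕ) : Set V :=
  {v | ∀ t, m + Finsupp.single v t ∈ M}

lemma rays_anti (hM : M.OrdConnected) {m m' : V →₀ ℕ} (hm : m ∈ M) (h : m ≤ m') :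
    rays M m' ⊆ rays M m :=
  fun _ hv t => hM.out hm (hv t) ⟨le_self_add, add_le_add_left h _⟩

/-- The elements of `M` which are not of the form `m + t e_v` with `m ∈ M` and `t ≠ 0`. -/
def base (M : Set (V →₀ ℕ)) (v : V) : Set (V →₀ ℕ) :=
  {b ∈ M | ∀ m ∈ M, ∀ t, m + Finsupp.single v t = b → t = 0}

lemma base_ordConnected (hM : M.OrdConnected) (v : V) : (base M v).OrdConnected := by
  refine ⟨fun a ha b hb c hc => ⟨hM.out ha.1 hb.1 hc, fun m hm t h => ?_⟩⟩
  obtain ⟨x, rfl⟩ := exists_add_of_le hc.2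
  have hmx : m + x + Finsupp.single v t = c + x := by rw [← h, add_right_comm]
  exact hb.2 (m + x) (hM.out hm hb.1 ⟨le_self_add, hmx ▸ le_self_add⟩) t hmx

lemma mem_supported_singleton_iff {v : V} {m : V →₀ ℕ} :
    m ∈ Finsupp.supported ℕ ℕ {v} ↔ ∃ t, m = Finsupp.single v t := by
  rw [← Finsupp.support_subset_singleton', Finsupp.mem_supported, ← Finset.coe_singleton,
    Finset.coe_subset]

lemma base_add_supported_singleton {v : V} (hv : ∀ m ∈ M, v ∈ rays M m) :
    base M v + (Finsupp.supported ℕ ℕ {v} : Set (V →₀ ℕ)) = M := by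
  refine subset_antisymm ?_ fun m hm => ?_
  · rintro _ ⟨b, hb, x, hx, rfl⟩
    obtain ⟨t, rfl⟩ := mem_supported_singleton_iff.1 hx
    exact hv b hb.1 t
  · obtain ⟨b, -, ⟨hb, t, hbt⟩, hmin⟩ := exists_minimal_le_of_wellFoundedLT
      (fun b => b ∈ M ∧ ∃ t, b + Finsupp.single v t = m) m ⟨hm, 0, by simp⟩
    refine ⟨b, ⟨hb, ?_⟩, _, mem_supported_singleton_iff.2 ⟨t, rfl⟩, hbt⟩
    rintro b' hb' s rfl
    have := hmin ⟨hb', s + t, by rw [Finsupp.single_add, ← add_assoc, hbt]⟩ le_self_add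
    simpa using this

lemma injOn_add_base_supported_singleton (M : Set (V →₀ ℕ)) (v : V) :
    Set.InjOn (fun p : (V →₀ ℕ) × (V →₀ ℕ) => p.1 + p.2)
      (base M v ×ˢ (Finsupp.supported ℕ ℕ {v} : Set (V →₀ ℕ))) := by
  rintro ⟨b, x⟩ ⟨hb, hx⟩ ⟨b', x'⟩ ⟨hb', hx'⟩ (h : b + x = b' + x')
  obtain ⟨t, rfl⟩ := mem_supported_singleton_iff.1 hx
  obtain ⟨t', rfl⟩ := mem_supported_singleton_iff.1 hx'
  wlog htt : t ≤ t' generalizing b b' t t'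
  · exact (this _ _ _ hb' hx' _ hb hx h.symm (le_of_not_ge htt)).symm
  obtain ⟨s, rfl⟩ := exists_add_of_le htt
  have hbs : b' + Finsupp.single v s = b := by
    rw [Finsupp.single_add, add_left_comm, add_comm b] at h
    exact (add_left_cancel h).symm
  obtain rfl := hb.2 b' hb'.1 s hbs
  simp_all

lemma hasStanleyPartition_one_of_forall_mem_rays [Finite V] (hM : M.OrdConnected) {v : V}
    (hv : ∀ m ∈ M, v ∈ rays M m) : HasStanleyPartition M 1 := by
  simpa only [base_add_supported_singleton hv, Nat.card_unique, zero_add] using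
    (hasStanleyPartition_zero_of_ordConnected (base_ordConnected hM v)).add
      (hasStanleyPartition_supported {v}) (injOn_add_base_supported_singleton M v)

lemma hasStanleyPartition_one_of_rays_nonempty [Finite V] (hM : M.OrdConnected)
    (hrays : ∀ m ∈ M, (rays M m).Nonempty) : HasStanleyPartition M 1 := by
  obtain ⟨n, ⟨e⟩⟩ := Finite.exists_equiv_fin V
  let N (v : V) : Set (V →₀ ℕ) := {m ∈ M | v ∈ rays M m ∧ ∀ w ∈ rays M m, e w ≤ e v}
  have hMN : ⋃ v, N v = M := by
    refine subset_antisymm (Set.iUnion_subset fun v m hm => hm.1) fun m hm => ?_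
    obtain ⟨v, hv, hmax⟩ := Set.exists_max_image _ e (Set.toFinite (rays M m)) (hrays m hm)
    exact Set.mem_iUnion.2 ⟨v, hm, hv, hmax⟩
  rw [← hMN]
  refine HasStanleyPartition.iUnion (fun v => ?_) fun v w hvw => Set.disjoint_left.2
    fun m hv hw => hvw (e.injective (le_antisymm (hw.2.2 v hv.2.1) (hv.2.2 w hw.2.1)))
  refine hasStanleyPartition_one_of_forall_mem_rays (v := v)
    ⟨fun a ha b hb m hm => ?_⟩ fun m hm t => ⟨hm.2.1 t, fun s => ?_, fun w hw => ?_⟩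
  · have hmM := hM.out ha.1 hb.1 hm
    exact ⟨hmM, rays_anti hM hmM hm.2 hb.2.1, fun w hw => ha.2.2 w (rays_anti hM ha.1 hm.1 hw)⟩
  · rw [add_assoc, ← Finsupp.single_add]
    exact hm.2.1 _
  · exact hm.2.2 w (rays_anti hM hm.1 le_self_add hw)

end OrdConnected

section Order

variable {V : Type*} {A B : Set V} {S : Set (V →₀ ℕ)} {a b m : V →₀ ℕ}

/-- The multisets of elements of `S` with sum at most `m`, i.e. the products of the generators
`X ^ s`, `s ∈ S`, which divide `X ^ m`. -/
def packings (S : Set (V →₀ ℕ)) (m : V →₀ ℕ) : Set (Multiset (V →₀ ℕ)) :=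
  {T | (∀ s ∈ T, s ∈ S) ∧ T.sum ≤ m}

/-- The largest `k` such that `X ^ m` lies in the `k`-th power of the ideal generated by the
monomials `X ^ s`, `s ∈ S`. Meant for `0 ∉ S`; otherwise there are arbitrarily large packings and
the supremum takes the value `0`. -/
noncomputable def order (S : Set (V →₀ ℕ)) (m : V →₀ ℕ) : ℕ :=
  sSup (Multiset.card '' packings S m)

lemma card_le_degree_of_mem_packings (hS : 0 ∉ S) {T : Multiset (V →₀ ℕ)} (hT : T ∈ packings S m) :
    T.card ≤ m.degree := by
  have h (x) (hx : x ∈ T.map Finsupp.degree) : 1 ≤ x := by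
    obtain ⟨s, hs, rfl⟩ := Multiset.mem_map.1 hx
    rw [Nat.one_le_iff_ne_zero, Ne, Finsupp.degree_eq_zero_iff]
    rintro rfl
    exact hS (hT.1 0 hs)
  calc T.card ≤ (T.map Finsupp.degree).sum := by
        simpa using Multiset.card_nsmul_le_sum h
    _ = T.sum.degree := (map_multiset_sum Finsupp.degree T).symm
    _ ≤ m.degree := Finsupp.degree_mono hT.2

lemma bddAbove_card_packings (hS : 0 ∉ S) (m : V →₀ ℕ) :
    BddAbove (Multiset.card '' packings S m) :=
  ⟨m.degree, Set.forall_mem_image.2 fun _ => card_le_degree_of_mem_packings hS⟩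

lemma card_le_order (hS : 0 ∉ S) {T : Multiset (V →₀ ℕ)} (hT : T ∈ packings S m) :
    T.card ≤ order S m :=
  le_csSup (bddAbove_card_packings hS m) ⟨T, hT, rfl⟩

lemma exists_mem_packings_card_eq_order (hS : 0 ∉ S) (m : V →₀ ℕ) :
    ∃ T ∈ packings S m, T.card = order S m :=
  Nat.sSup_mem (s := Multiset.card '' packings S m) ⟨0, 0, by simp [packings]⟩
    (bddAbove_card_packings hS m)

lemma mem_packings_of_le {T T' : Multiset (V →₀ ℕ)} (hT : T ∈ packings S m) (h : T' ≤ T) :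
    T' ∈ packings S m := by
  obtain ⟨T'', rfl⟩ := Multiset.le_iff_exists_add.1 h
  exact ⟨fun s hs => hT.1 s (Multiset.mem_of_le h hs),
    (Multiset.sum_add T' T'' ▸ le_self_add).trans hT.2⟩

lemma add_mem_packings {T T' : Multiset (V →₀ ℕ)} (hT : T ∈ packings S a)
    (hT' : T' ∈ packings S b) : T + T' ∈ packings S (a + b) :=
  ⟨fun s hs => (Multiset.mem_add.1 hs).elim (hT.1 s) (hT'.1 s),
    Multiset.sum_add T T' ▸ add_le_add hT.2 hT'.2⟩

lemma le_order_iff (hS : 0 ∉ S) {k : ℕ} : k ≤ order S m ↔ ∃ T ∈ packings S m, T.card = k := by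
  refine ⟨fun h => ?_, fun ⟨T, hT, hk⟩ => hk ▸ card_le_order hS hT⟩
  obtain ⟨⟨l⟩, hl, hlm⟩ := exists_mem_packings_card_eq_order hS m
  exact ⟨l.take k, mem_packings_of_le hl (List.take_sublist k l).subperm,
    List.length_take_of_le (h.trans hlm.ge)⟩

lemma order_mono (hS : 0 ∉ S) : Monotone (order S) := by
  intro m m' h
  obtain ⟨T, hT, hTm⟩ := exists_mem_packings_card_eq_order hS m
  exact hTm ▸ card_le_order hS ⟨hT.1, hT.2.trans h⟩

lemma order_add_le (hS : 0 ∉ S) (a b : V →₀ ℕ) : order S a + order S b ≤ order S (a + b) := by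
  obtain ⟨T, hT, hTa⟩ := exists_mem_packings_card_eq_order hS a
  obtain ⟨T', hT', hTb⟩ := exists_mem_packings_card_eq_order hS b
  rw [← hTa, ← hTb, ← Multiset.card_add]
  exact card_le_order hS (add_mem_packings hT hT')

lemma order_add (hS : 0 ∉ S) (hAB : Disjoint A B)
    (hSAB : ∀ s ∈ S, s ∈ Finsupp.supported ℕ ℕ (A ∪ B) →
      s ∈ Finsupp.supported ℕ ℕ A ∨ s ∈ Finsupp.supported ℕ ℕ B)
    (ha : a ∈ Finsupp.supported ℕ ℕ A) (hb : b ∈ Finsupp.supported ℕ ℕ B) :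
    order S (a + b) = order S a + order S b := by
  classical
  refine le_antisymm ?_ (order_add_le hS a b)
  have hab : a + b ∈ Finsupp.supported ℕ ℕ (A ∪ B) := by
    rw [← SetLike.mem_coe, supported_union_eq_add]
    exact Set.add_mem_add ha hb
  obtain ⟨T, hT, hTm⟩ := exists_mem_packings_card_eq_order hS (a + b)
  let TA := T.filter (· ∈ Finsupp.supported ℕ ℕ A)
  let TB := T.filter (· ∉ Finsupp.supported ℕ ℕ A)
  have hT_eq : TA + TB = T := Multiset.filter_add_not _ T
  have hTA : TA.sum ∈ Finsupp.supported ℕ ℕ A :=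
    multiset_sum_mem _ fun s hs => (Multiset.mem_filter.1 hs).2
  have hTB : TB.sum ∈ Finsupp.supported ℕ ℕ B := multiset_sum_mem _ fun s hs => by
    obtain ⟨hsT, hsA⟩ := Multiset.mem_filter.1 hs
    refine (hSAB s (hT.1 s hsT) (mem_supported_of_le ?_ hab)).resolve_left hsA
    exact (Multiset.single_le_sum (fun _ _ => zero_le) s hsT).trans hT.2
  have hsum : TA.sum ≤ a ∧ TB.sum ≤ b := by
    rw [← add_le_add_iff_of_mem_supported hAB hTA ha hTB hb, ← Multiset.sum_add, hT_eq]
    exact hT.2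
  have hTA_mem : TA ∈ packings S a := ⟨fun s hs => hT.1 s (Multiset.mem_of_mem_filter hs), hsum.1⟩
  have hTB_mem : TB ∈ packings S b := ⟨fun s hs => hT.1 s (Multiset.mem_of_mem_filter hs), hsum.2⟩
  rw [← hTm, ← hT_eq, Multiset.card_add]
  exact add_le_add (card_le_order hS hTA_mem) (card_le_order hS hTB_mem)

end Order

section TruncLevel

variable {V : Type*} {A B : Set V} {ν : (V →₀ ℕ) → ℕ}

/-- The exponent vectors supported on `A` on which `ν`, truncated at `k`, takes the value `j`. If
`ν` is the order with respect to generators of an ideal `I` of `K[A]`, these describe a basis of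
`I ^ j / I ^ (j + 1)` for `j < k` and of `I ^ k` for `j = k`. -/
def truncLevel (ν : (V →₀ ℕ) → ℕ) (A : Set V) (k j : ℕ) : Set (V →₀ ℕ) :=
  {m ∈ Finsupp.supported ℕ ℕ A | min (ν m) k = j}

lemma truncLevel_ordConnected (hν : Monotone ν) (A : Set V) (k j : ℕ) :
    (truncLevel ν A k j).OrdConnected := by
  refine ⟨fun a ha b hb m hm => ⟨mem_supported_of_le hm.2 hb.1, ?_⟩⟩
  exact le_antisymm (hb.2 ▸ min_le_min_right k (hν hm.2)) (ha.2 ▸ min_le_min_right k (hν hm.1))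

lemma truncLevel_union
    (hν : ∀ a ∈ Finsupp.supported ℕ ℕ A, ∀ b ∈ Finsupp.supported ℕ ℕ B, ν (a + b) = ν a + ν b)
    (k j : ℕ) : truncLevel ν (A ∪ B) k j =
      ⋃ i : Fin (j + 1), truncLevel ν A k i + truncLevel ν B (k - i) (j - i) := by
  ext m
  simp only [Set.mem_iUnion]
  constructor
  · rintro ⟨hm, hmj⟩
    rw [← SetLike.mem_coe, supported_union_eq_add] at hm
    obtain ⟨a, ha, b, hb, rfl⟩ := hm
    simp only [hν a ha b hb] at hmj
    exact ⟨⟨min (ν a) k, by omega⟩, Set.add_mem_add ⟨ha, rfl⟩ ⟨hb, by simp only; omega⟩⟩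
  · rintro ⟨i, a, ⟨ha, hai⟩, b, ⟨hb, hbi⟩, rfl⟩
    refine ⟨Finsupp.supported_union (R := ℕ) (M := ℕ) A B ▸ Submodule.add_mem_sup ha hb, ?_⟩
    simp only [hν a ha b hb]
    omega

lemma hasStanleyPartition_truncLevel_union {d e : ℕ} (hAB : Disjoint A B)
    (hν : ∀ a ∈ Finsupp.supported ℕ ℕ A, ∀ b ∈ Finsupp.supported ℕ ℕ B, ν (a + b) = ν a + ν b)
    {k j : ℕ} (hA : ∀ i ≤ j, HasStanleyPartition (truncLevel ν A k i) d)
    (hB : ∀ i ≤ j, HasStanleyPartition (truncLevel ν B (k - i) (j - i)) e) :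
    HasStanleyPartition (truncLevel ν (A ∪ B) k j) (d + e) := by
  have hinj := injOn_add_of_disjoint hAB
  rw [truncLevel_union hν]
  refine HasStanleyPartition.iUnion (fun i => ?_) fun i i' hii' => ?_
  · have hi := Nat.lt_succ_iff.1 i.2
    exact (hA i hi).add (hB i hi) (hinj.mono (Set.prod_mono (fun _ h => h.1) fun _ h => h.1))
  · refine Set.disjoint_left.2 ?_
    rintro _ ⟨a, ha, b, hb, rfl⟩ ⟨a', ha', b', hb', h⟩
    obtain ⟨rfl, rfl⟩ := Prod.mk.inj <| hinj (x₁ := (a', b')) (x₂ := (a, b))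
      ⟨ha'.1, hb'.1⟩ ⟨ha.1, hb.1⟩ h
    exact hii' (Fin.ext (ha.2.symm.trans ha'.2))

end TruncLevel

section Transport

variable {V W : Type*} {S : Set (V →₀ ℕ)} {S' : Set (W →₀ ℕ)} {f : V ↪ W}

lemma mapDomain_le_mapDomain_iff (f : V ↪ W) {a b : V →₀ ℕ} :
    Finsupp.mapDomain f a ≤ Finsupp.mapDomain f b ↔ a ≤ b := by
  refine ⟨fun h v => ?_, fun h => ?_⟩
  · simpa only [Finsupp.mapDomain_apply f.injective] using h (f v)
  · obtain ⟨c, rfl⟩ := exists_add_of_le h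
    rw [Finsupp.mapDomain_add]
    exact le_self_add

lemma mapDomain_mem_supported_range (f : V ↪ W) (m : V →₀ ℕ) :
    Finsupp.mapDomain f m ∈ Finsupp.supported ℕ ℕ (Set.range f) := by
  rw [← Set.image_univ, ← Finsupp.lmapDomain_supported]
  exact Submodule.mem_map_of_mem (by simp)

lemma packings_mapDomain (hS : ∀ s, Finsupp.mapDomain f s ∈ S' ↔ s ∈ S) (m : V →₀ ℕ) :
    packings S' (Finsupp.mapDomain f m) =
      Multiset.map (Finsupp.mapDomain f) '' packings S m := by
  have hsum (U : Multiset (V →₀ ℕ)) :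
      (U.map (Finsupp.mapDomain f)).sum = Finsupp.mapDomain f U.sum :=
    (map_multiset_sum (Finsupp.mapDomain.addMonoidHom f) U).symm
  refine subset_antisymm (fun T hT => ?_) ?_
  · have hT_range (s) (hs : s ∈ T) :
        Finsupp.mapDomain f (Finsupp.comapDomain f s f.injective.injOn) = s :=
      Finsupp.mapDomain_comapDomain f f.injective s <| mem_supported_of_le
        ((Multiset.single_le_sum (fun _ _ => zero_le) s hs).trans hT.2)
        (mapDomain_mem_supported_range f m)
    obtain ⟨U, rfl⟩ : ∃ U, Multiset.map (Finsupp.mapDomain f) U = T :=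
      ⟨T.map fun s => Finsupp.comapDomain f s f.injective.injOn, by
        rw [Multiset.map_map]
        exact (Multiset.map_congr rfl hT_range).trans T.map_id'⟩
    refine ⟨U, ⟨fun s hs => (hS s).1 (hT.1 _ (Multiset.mem_map_of_mem _ hs)), ?_⟩, rfl⟩
    rw [← mapDomain_le_mapDomain_iff f, ← hsum]
    exact hT.2
  · rintro _ ⟨U, hU, rfl⟩
    refine ⟨fun s hs => ?_, (hsum U).trans_le ((mapDomain_le_mapDomain_iff f).2 hU.2)⟩
    obtain ⟨u, hu, rfl⟩ := Multiset.mem_map.1 hs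
    exact (hS u).2 (hU.1 u hu)

lemma order_mapDomain (hS : ∀ s, Finsupp.mapDomain f s ∈ S' ↔ s ∈ S) (m : V →₀ ℕ) :
    order S' (Finsupp.mapDomain f m) = order S m := by
  simp only [order, packings_mapDomain hS, Set.image_image, Multiset.card_map]

lemma image_mapDomain_truncLevel (hS : ∀ s, Finsupp.mapDomain f s ∈ S' ↔ s ∈ S) (A : Set V)
    (k j : ℕ) : Finsupp.mapDomain f '' truncLevel (order S) A k j =
      truncLevel (order S') (f '' A) k j := by
  have hA := congrArg SetLike.coe (Finsupp.lmapDomain_supported ℕ ℕ f A)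
  rw [Submodule.map_coe] at hA
  ext m
  simp only [truncLevel, Set.mem_ofPred_eq, Set.mem_image, ← SetLike.mem_coe, ← hA]
  constructor
  · rintro ⟨a, ⟨ha, haj⟩, rfl⟩
    exact ⟨⟨a, ha, rfl⟩, by rwa [order_mapDomain hS]⟩
  · rintro ⟨⟨a, ha, rfl⟩, haj⟩
    exact ⟨a, ⟨ha, (congrArg (min · k) (order_mapDomain hS a)).symm.trans haj⟩, rfl⟩

end Transport

section EdgeExponents

variable {V W : Type*} {G : SimpleGraph V} {F : SimpleGraph W} {A B : Set V}

/-- The exponent vectors of the generators of the edge ideal of `G`. -/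
def edgeExponents (G : SimpleGraph V) : Set (V →₀ ℕ) :=
  {s | ∃ v w, G.Adj v w ∧ s = Finsupp.single v 1 + Finsupp.single w 1}

lemma zero_notMem_edgeExponents (G : SimpleGraph V) : 0 ∉ edgeExponents G := by
  rintro ⟨v, w, -, h⟩
  have hv := DFunLike.congr_fun h v
  simp only [Finsupp.coe_zero, Pi.zero_apply, Finsupp.add_apply, Finsupp.single_eq_same] at hv
  omega

lemma single_add_single_mem_supported_iff {v w : V} :
    Finsupp.single v 1 + Finsupp.single w 1 ∈ Finsupp.supported ℕ ℕ A ↔ v ∈ A ∧ w ∈ A := by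
  refine ⟨fun h => ?_, fun h => add_mem (Finsupp.single_mem_supported ℕ 1 h.1)
    (Finsupp.single_mem_supported ℕ 1 h.2)⟩
  exact ⟨h (by simp), h (by simp)⟩

lemma mapDomain_mem_edgeExponents_iff (f : F ↪g G) (s : W →₀ ℕ) :
    Finsupp.mapDomain f.toEmbedding s ∈ edgeExponents G ↔ s ∈ edgeExponents F := by
  constructor
  · rintro ⟨v, w, hvw, hs⟩
    obtain ⟨⟨a, rfl⟩, ⟨b, rfl⟩⟩ := single_add_single_mem_supported_iff.1
      (hs ▸ mapDomain_mem_supported_range f.toEmbedding s)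
    refine ⟨a, b, f.map_adj_iff.1 hvw, Finsupp.mapDomain_injective f.injective (hs.trans ?_)⟩
    simp [Finsupp.mapDomain_add, Finsupp.mapDomain_single]
  · rintro ⟨a, b, hab, rfl⟩
    exact ⟨f a, f b, f.map_adj_iff.2 hab, by simp [Finsupp.mapDomain_add]⟩

lemma order_edgeExponents_add (hAB : Disjoint A B) (h : ∀ v ∈ A, ∀ w ∈ B, ¬ G.Adj v w)
    {a b : V →₀ ℕ} (ha : a ∈ Finsupp.supported ℕ ℕ A) (hb : b ∈ Finsupp.supported ℕ ℕ B) :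
    order (edgeExponents G) (a + b) = order (edgeExponents G) a + order (edgeExponents G) b := by
  refine order_add (zero_notMem_edgeExponents G) hAB ?_ ha hb
  rintro _ ⟨v, w, hvw, rfl⟩ hs
  rw [single_add_single_mem_supported_iff] at hs ⊢
  rw [single_add_single_mem_supported_iff]
  grind [h v, h w, hvw.symm]

end EdgeExponents

section Konig

open Finset

/-- The deficiency version of Hall's theorem: adjoin `d` elements which match everything. -/
lemma exists_injective_mem_of_card_le_card_biUnion_add {α β : Type*} [Fintype α] [DecidableEq β]
    (t : α → Finset β) (d : ℕ) (h : ∀ s : Finset α, #s ≤ #(s.biUnion t) + d) :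
    ∃ (s : Finset α) (f : s → β), Function.Injective f ∧ (∀ a : s, f a ∈ t a) ∧
      Fintype.card α ≤ #s + d := by
  classical
  let t' (a : α) : Finset (β ⊕ Fin d) := (t a).disjSum univ
  have ht' (s : Finset α) : #s ≤ #(s.biUnion t') := by
    rcases s.eq_empty_or_nonempty with rfl | hs
    · simp
    · have : s.biUnion t' = (s.biUnion t).disjSum univ := by
        ext (b | i) <;> simp [t', hs.exists_mem]
      rw [this, card_disjSum, card_fin]
      exact h s
  obtain ⟨g, hg, hgt⟩ := (all_card_le_biUnion_card_iff_exists_injective t').1 ht'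
  let s : Finset α := {a | (g a).isLeft}
  have hs (a : s) : ∃ b ∈ t a, g a = Sum.inl b := by
    obtain ⟨b, hb⟩ := Sum.isLeft_iff.1 (mem_filter.1 a.2).2
    exact ⟨b, inl_mem_disjSum.1 (hb ▸ hgt a), hb⟩
  have hs_compl : #sᶜ ≤ #((univ : Finset (Fin d)).image (Sum.inr : Fin d → β ⊕ Fin d)) := by
    refine card_le_card_of_injOn g (fun a ha => ?_) hg.injOn
    obtain ⟨i, hi⟩ := Sum.isRight_iff.1 (Sum.not_isLeft.1 (by simpa [s] using ha))
    exact mem_coe.2 (mem_image.2 ⟨i, mem_univ i, hi.symm⟩)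
  choose f hft hf using hs
  refine ⟨s, f, fun a b hab => Subtype.ext (hg (by rw [hf, hf, hab])), hft, ?_⟩
  rw [card_image_of_injective _ Sum.inr_injective, card_fin] at hs_compl
  have := card_add_card_compl s
  omega

/-- Kőnig's theorem, for the bipartite graph in which `a` and `b` are adjacent if `b ∈ t a`. -/
lemma exists_cover_card_le_matching {α β : Type*} [Finite α] (t : α → Finset β) :
    ∃ (A : Finset α) (B : Finset β) (s : Finset α) (f : s → β), (∀ a ∉ A, t a ⊆ B) ∧
      Function.Injective f ∧ (∀ a : s, f a ∈ t a) ∧ #A + #B ≤ #s := by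
  classical
  have := Fintype.ofFinite α
  obtain ⟨u, -, hu⟩ := exists_max_image univ (fun u : Finset α => (#u : ℤ) - #(u.biUnion t))
    univ_nonempty
  have hu₀ : #(u.biUnion t) ≤ #u := by simpa using hu ∅ (mem_univ _)
  obtain ⟨s, f, hf, hft, hs⟩ := exists_injective_mem_of_card_le_card_biUnion_add t
    (#u - #(u.biUnion t)) fun v => by have := hu v (mem_univ v); omega
  refine ⟨uᶜ, u.biUnion t, s, f, fun a ha => ?_, hf, hft, ?_⟩
  · exact subset_biUnion_of_mem t (by simpa using ha)
  · have := card_add_card_compl u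
    omega

end Konig

section VertexCover

variable {V : Type*} {G : SimpleGraph V} {m : V →₀ ℕ}

lemma order_le_sum_of_isVertexCover {C : Finset V} (hC : G.IsVertexCover C) (m : V →₀ ℕ) :
    order (edgeExponents G) m ≤ ∑ v ∈ C, m v := by
  obtain ⟨T, hT, hTm⟩ := exists_mem_packings_card_eq_order (zero_notMem_edgeExponents G) m
  let φ : (V →₀ ℕ) →+ ℕ := ∑ v ∈ C, Finsupp.applyAddHom v
  have hφ (x : V →₀ ℕ) : φ x = ∑ v ∈ C, x v := by simp [φ]
  have h (n) (hn : n ∈ T.map φ) : 1 ≤ n := by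
    obtain ⟨s, hs, rfl⟩ := Multiset.mem_map.1 hn
    obtain ⟨v, w, hvw, rfl⟩ := hT.1 s hs
    rw [hφ, Nat.one_le_iff_ne_zero, Ne, Finset.sum_eq_zero_iff]
    rcases hC hvw with hv | hw
    · exact fun h0 => by simpa using h0 v hv
    · exact fun h0 => by simpa using h0 w hw
  calc order (edgeExponents G) m = T.card := hTm.symm
    _ ≤ (T.map φ).sum := by simpa using Multiset.card_nsmul_le_sum h
    _ = ∑ v ∈ C, T.sum v := by rw [← map_multiset_sum, hφ]
    _ ≤ ∑ v ∈ C, m v := Finset.sum_le_sum fun v _ => hT.2 v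

lemma sum_single_le (m : V →₀ ℕ) (s : Finset (Σ v, Fin (m v))) :
    ∑ x ∈ s, Finsupp.single x.1 1 ≤ m := by
  classical
  intro w
  calc (∑ x ∈ s, Finsupp.single x.1 1) w = (s.filter (·.1 = w)).card := by
        simp [Finsupp.finsetSum_apply, Finsupp.single_apply]
    _ ≤ (Finset.univ.image (Sigma.mk w) : Finset (Σ v, Fin (m v))).card := by
        refine Finset.card_le_card fun ⟨v, i⟩ hx => ?_
        obtain rfl : v = w := (Finset.mem_filter.1 hx).2
        exact Finset.mem_image_of_mem _ (Finset.mem_univ i)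
    _ ≤ m w := Finset.card_image_le.trans_eq (Finset.card_fin _)

lemma card_le_order_of_matching {s : Finset (Σ v, Fin (m v))}
    {f : s → Σ v, Fin (m v)} (hf : Function.Injective f) (hfs : ∀ x y : s, f x ≠ y)
    (hadj : ∀ x : s, G.Adj x.1.1 (f x).1) : s.card ≤ order (edgeExponents G) m := by
  classical
  let T : Multiset (V →₀ ℕ) :=
    (Finset.univ : Finset s).val.map fun x => Finsupp.single x.1.1 1 + Finsupp.single (f x).1 1
  have hdisj : Disjoint s (Finset.univ.image f) := by
    simp only [Finset.disjoint_right, Finset.mem_image, Finset.mem_univ, true_and]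
    rintro _ ⟨x, rfl⟩ hx
    exact hfs x ⟨f x, hx⟩ rfl
  have hT : T ∈ packings (edgeExponents G) m := by
    refine ⟨fun e he => ?_, ?_⟩
    · obtain ⟨x, -, rfl⟩ := Multiset.mem_map.1 he
      exact ⟨_, _, hadj x, rfl⟩
    · calc T.sum = ∑ x : s, (Finsupp.single x.1.1 1 + Finsupp.single (f x).1 1) := rfl
        _ = ∑ x ∈ s, Finsupp.single x.1 1 + ∑ x ∈ Finset.univ.image f, Finsupp.single x.1 1 := by
          rw [Finset.sum_add_distrib, Finset.sum_image hf.injOn,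
            Finset.sum_coe_sort s fun x => Finsupp.single x.1 1]
        _ ≤ m := by
          rw [← Finset.sum_union hdisj]
          exact sum_single_le m _
  calc s.card = T.card := by simp only [T, Multiset.card_map, Finset.card_val, Finset.card_univ,
        Fintype.card_coe]
    _ ≤ order (edgeExponents G) m := card_le_order (zero_notMem_edgeExponents G) hT

lemma sum_filter_forall_mem_le_card [Fintype V] [DecidableEq V] (D : Finset (Σ v, Fin (m v))) :
    ∑ v with ∀ i, ⟨v, i⟩ ∈ D, m v ≤ D.card := by
  calc ∑ v with ∀ i, ⟨v, i⟩ ∈ D, m v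
      = (Finset.sigma {v | ∀ i, ⟨v, i⟩ ∈ D} fun v => (Finset.univ : Finset (Fin (m v)))).card := by
        simp only [Finset.card_sigma, Finset.card_fin]
    _ ≤ D.card := Finset.card_le_card fun ⟨v, i⟩ hv =>
        (Finset.mem_filter.1 (Finset.mem_sigma.1 hv).1).2 i

lemma exists_isVertexCover_sum_le_order [Finite V] (hG : G.IsBipartite) (m : V →₀ ℕ) :
    ∃ C : Finset V, G.IsVertexCover C ∧ ∑ v ∈ C, m v ≤ order (edgeExponents G) m := by
  classical
  have := Fintype.ofFinite V
  obtain ⟨c⟩ := hG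
  -- Kőnig's theorem for the graph in which each vertex `v` of `G` is replaced by `m v` copies.
  let t (x : Σ v, Fin (m v)) : Finset (Σ v, Fin (m v)) := {y | c x.1 = 0 ∧ G.Adj x.1 y.1}
  obtain ⟨A, B, s, f, hAB, hf, hft, hcard⟩ := exists_cover_card_le_matching t
  have hfs (x : s) : c x.1.1 = 0 ∧ G.Adj x.1.1 (f x).1 := by simpa [t] using hft x
  have hs : s.card ≤ order (edgeExponents G) m := by
    refine card_le_order_of_matching hf (fun x y hxy => ?_) fun x => (hfs x).2
    exact c.valid (hfs x).2 ((hfs x).1.trans (hxy ▸ (hfs y).1).symm)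
  have hcover {v w} (hvw : G.Adj v w) (hv : c v = 0) : (∀ i, ⟨v, i⟩ ∈ A) ∨ ∀ i, ⟨w, i⟩ ∈ B := by
    by_contra! h
    obtain ⟨⟨i, hi⟩, j, hj⟩ := h
    exact hj (hAB _ hi (by simpa [t] using ⟨hv, hvw⟩))
  let full (D : Finset (Σ v, Fin (m v))) : Finset V := {v | ∀ i, ⟨v, i⟩ ∈ D}
  refine ⟨full A ∪ full B, fun v w hvw => ?_, ?_⟩
  · have hc : c v = 0 ∨ c w = 0 := by have := c.valid hvw; omega
    simp only [full, Finset.coe_union, Finset.coe_filter, Finset.mem_univ, true_and, Set.mem_union,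
      Set.mem_ofPred_eq]
    rcases hc with hv | hw
    · exact (hcover hvw hv).imp .inl .inr
    · exact (hcover hvw.symm hw).symm.imp .inr .inl
  · calc ∑ v ∈ full A ∪ full B, m v ≤ ∑ v ∈ full A, m v + ∑ v ∈ full B, m v :=
          le_self_add.trans Finset.sum_union_inter.le
      _ ≤ A.card + B.card :=
        add_le_add (sum_filter_forall_mem_le_card A) (sum_filter_forall_mem_le_card B)
      _ ≤ order (edgeExponents G) m := hcard.trans hs

lemma exists_isVertexCover_ne_univ [Finite V] [Nonempty V] (hG : G.IsBipartite) (m : V →₀ ℕ) :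
    ∃ C : Finset V, G.IsVertexCover C ∧ (∃ v, v ∉ C) ∧
      ∑ v ∈ C, m v ≤ order (edgeExponents G) m := by
  classical
  have := Fintype.ofFinite V
  obtain ⟨C, hC, hCm⟩ := exists_isVertexCover_sum_le_order hG m
  by_cases hv : ∃ v, v ∉ C
  · exact ⟨C, hC, hv, hCm⟩
  obtain ⟨c⟩ := hG
  obtain ⟨v⟩ := ‹Nonempty V›
  refine ⟨Finset.univ.filter (c · ≠ c v), fun x y hxy => ?_, ⟨v, by simp⟩, le_trans ?_ hCm⟩
  · have := c.valid hxy
    simp only [Finset.coe_filter, Finset.mem_univ, true_and, Set.mem_ofPred_eq]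
    grind
  · exact Finset.sum_le_sum_of_subset fun w _ => not_not.1 fun hw => hv ⟨w, hw⟩

lemma exists_forall_order_add_single_eq [Finite V] [Nonempty V] (hG : G.IsBipartite)
    (m : V →₀ ℕ) :
    ∃ v, ∀ t, order (edgeExponents G) (m + Finsupp.single v t) = order (edgeExponents G) m := by
  obtain ⟨C, hC, ⟨v, hv⟩, hCm⟩ := exists_isVertexCover_ne_univ hG m
  refine ⟨v, fun t => le_antisymm ?_ (order_mono (zero_notMem_edgeExponents G) le_self_add)⟩
  calc order (edgeExponents G) (m + Finsupp.single v t) ≤ ∑ w ∈ C, (m + Finsupp.single v t) w :=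
        order_le_sum_of_isVertexCover hC _
    _ = ∑ w ∈ C, m w := Finset.sum_congr rfl fun w hw => by
        simp [ne_of_mem_of_not_mem hw hv]
    _ ≤ order (edgeExponents G) m := hCm

end VertexCover

section PowersHaveDepth

variable {V W : Type*} {G : SimpleGraph V} {F : SimpleGraph W} {A B : Set V} {d e : ℕ}

/-- For the subgraph of `G` induced on a union `A` of connected components, with edge ideal `I` in
`K[A]`, all the quotients `I ^ j / I ^ (j + 1)` and all the powers `I ^ k` have a Stanley
decomposition into spaces of dimension at least `d`. -/
def PowersHaveDepth (G : SimpleGraph V) (A : Set V) (d : ℕ) : Prop :=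
  ∀ k j, HasStanleyPartition (truncLevel (order (edgeExponents G)) A k j) d

lemma truncLevel_edgeExponents_ordConnected (G : SimpleGraph V) (A : Set V) (k j : ℕ) :
    (truncLevel (order (edgeExponents G)) A k j).OrdConnected :=
  truncLevel_ordConnected (order_mono (zero_notMem_edgeExponents G)) A k j

lemma powersHaveDepth_zero [Finite V] (G : SimpleGraph V) (A : Set V) : PowersHaveDepth G A 0 :=
  fun k j => hasStanleyPartition_zero_of_ordConnected
    (truncLevel_edgeExponents_ordConnected G A k j)

lemma PowersHaveDepth.union (hA : PowersHaveDepth G A d) (hB : PowersHaveDepth G B e)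
    (hAB : Disjoint A B) (h : ∀ v ∈ A, ∀ w ∈ B, ¬ G.Adj v w) :
    PowersHaveDepth G (A ∪ B) (d + e) := fun k j =>
  hasStanleyPartition_truncLevel_union hAB
    (fun _ ha _ hb => order_edgeExponents_add hAB h ha hb)
    (fun i _ => hA k i) (fun i _ => hB (k - i) (j - i))

lemma hasStanleyPartition_truncLevel_image (f : F ↪g G) {A : Set W} {k j : ℕ}
    (h : HasStanleyPartition (truncLevel (order (edgeExponents F)) A k j) d) :
    HasStanleyPartition (truncLevel (order (edgeExponents G)) (f '' A) k j) d :=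
  image_mapDomain_truncLevel (mapDomain_mem_edgeExponents_iff f) A k j ▸
    h.image_mapDomain f.toEmbedding

lemma hasStanleyPartition_truncLevel_of_induce {k j : ℕ}
    (h : HasStanleyPartition (truncLevel (order (edgeExponents (G.induce A))) Set.univ k j) d) :
    HasStanleyPartition (truncLevel (order (edgeExponents G)) A k j) d := by
  have h' := hasStanleyPartition_truncLevel_image (SimpleGraph.Embedding.induce (G := G) A) h
  rwa [Set.image_univ, show Set.range (SimpleGraph.Embedding.induce (G := G) A) = A from
    Subtype.range_coe] at h'

lemma powersHaveDepth_univ_one [Finite V] [Nonempty V] (hG : G.IsBipartite) :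
    PowersHaveDepth G Set.univ 1 := by
  refine fun k j => hasStanleyPartition_one_of_rays_nonempty
    (truncLevel_edgeExponents_ordConnected G Set.univ k j) fun m hm => ?_
  obtain ⟨v, hv⟩ := exists_forall_order_add_single_eq hG m
  exact ⟨v, fun t => ⟨by simp, by rw [hv t]; exact hm.2⟩⟩

open Classical in
lemma powersHaveDepth_connectedComponent [Finite V] (D : G.ConnectedComponent) :
    PowersHaveDepth G D.supp (if D.toSimpleGraph.IsBipartite then 1 else 0) := by
  split_ifs with hD
  · have := D.nonempty_supp.to_subtype
    exact fun k j => hasStanleyPartition_truncLevel_of_induce (powersHaveDepth_univ_one hD k j)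
  · exact powersHaveDepth_zero G D.supp

lemma powersHaveDepth_biUnion_connectedComponent [Finite V] {d : G.ConnectedComponent → ℕ}
    (hd : ∀ D : G.ConnectedComponent, PowersHaveDepth G D.supp (d D))
    (s : Finset G.ConnectedComponent) :
    PowersHaveDepth G (⋃ D ∈ s, D.supp) (∑ D ∈ s, d D) := by
  classical
  induction s using Finset.induction with
  | empty => exact powersHaveDepth_zero G _
  | insert D s hDs ih =>
    rw [Finset.set_biUnion_insert, Finset.sum_insert hDs]
    have hmem (v) : v ∈ ⋃ D ∈ s, D.supp ↔ G.connectedComponentMk v ∈ s := by simp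
    refine (hd D).union ih (Set.disjoint_left.2 ?_) ?_
    · rintro v rfl hv
      exact hDs ((hmem v).1 hv)
    · rintro v rfl w hw hvw
      exact hDs (SimpleGraph.ConnectedComponent.connectedComponentMk_eq_of_adj hvw ▸ (hmem w).1 hw)

lemma powersHaveDepth_numBipartiteComponents [Finite V] (G : SimpleGraph V) :
    PowersHaveDepth G Set.univ (numBipartiteComponents G) := by
  classical
  have := Fintype.ofFinite G.ConnectedComponent
  have h := powersHaveDepth_biUnion_connectedComponent powersHaveDepth_connectedComponent
    (Finset.univ : Finset G.ConnectedComponent)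
  have hsupp : ⋃ D : G.ConnectedComponent, D.supp = Set.univ := G.iUnion_connectedComponentSupp
  have hcard : ∑ D : G.ConnectedComponent, (if D.toSimpleGraph.IsBipartite then 1 else 0) =
      numBipartiteComponents G := by
    rw [Finset.sum_boole, numBipartiteComponents, Set.ncard_eq_toFinset_card']
    simp
  simpa only [Finset.mem_univ, Set.iUnion_true, hsupp, hcard] using h

end PowersHaveDepth

section RestrictSupport

variable {σ ι R : Type*} [CommSemiring R]

lemma restrictSupport_iUnion {κ : Sort*} (B : κ → Set (σ →₀ ℕ)) :
    restrictSupport R (⋃ i, B i) = ⨆ i, restrictSupport R (B i) := by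
  simp only [restrictSupport_eq_span, Set.image_iUnion, Submodule.span_iUnion]

lemma restrictSupport_le_iff [Nontrivial R] {A B : Set (σ →₀ ℕ)} :
    restrictSupport R A ≤ restrictSupport R B ↔ A ⊆ B := by
  refine ⟨fun h m hm => ?_, restrictSupport_mono R⟩
  have : monomial m (1 : R) ∈ restrictSupport R B := h (by simp [hm])
  simpa using this

lemma restrictSupport_injective [Nontrivial R] :
    Function.Injective (restrictSupport (σ := σ) R) := fun _ _ h =>
  (restrictSupport_le_iff.1 h.le).antisymm (restrictSupport_le_iff.1 h.ge)

lemma disjoint_restrictSupport_iff [Nontrivial R] {A B : Set (σ →₀ ℕ)} :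
    Disjoint (restrictSupport R A) (restrictSupport R B) ↔ Disjoint A B := by
  rw [Submodule.disjoint_def, Set.disjoint_left]
  refine ⟨fun h m hA hB => ?_, fun h p hA hB => ?_⟩
  · simpa using h (monomial m 1) (by simp [hA]) (by simp [hB])
  · rw [← support_eq_empty, Finset.eq_empty_iff_forall_notMem]
    exact fun m hm => h (hA hm) (hB hm)

lemma iSupIndep_restrictSupport_iff [Nontrivial R] {B : ι → Set (σ →₀ ℕ)} :
    (iSupIndep fun i => restrictSupport R (B i)) ↔ Pairwise (Disjoint on B) := by
  refine ⟨fun h i j hij => disjoint_restrictSupport_iff.1 (h.pairwiseDisjoint hij), fun h i => ?_⟩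
  simp only [← restrictSupport_iUnion, disjoint_restrictSupport_iff, Set.disjoint_iUnion_right]
  exact fun j hj => h hj.symm

lemma toSubmodule_supported (s : Set σ) :
    Subalgebra.toSubmodule (supported R s) = restrictSupport R (Finsupp.supported ℕ ℕ s) := by
  ext p
  simp only [Subalgebra.mem_toSubmodule, mem_supported, mem_restrictSupport_iff]
  refine ⟨fun h m hm v hv => h ((mem_vars_iff_mem_support v).2 ⟨m, hm, hv⟩), fun h v hv => ?_⟩
  obtain ⟨m, hm, hv⟩ := (mem_vars_iff_mem_support v).1 hv
  exact h hm hv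

lemma restrictSupport_singleton {c : R} (hc : IsUnit c) (u : σ →₀ ℕ) :
    restrictSupport R {u} = R ∙ monomial u c := by
  rw [restrictSupport_eq_span, Set.image_singleton,
    ← Submodule.span_singleton_smul_eq hc (monomial u 1), smul_monomial, smul_eq_mul, mul_one]

end RestrictSupport

section MonomialIdeal

variable {σ K : Type*} [Field K] {I : Ideal (MvPolynomial σ K)} {u : σ →₀ ℕ} {c : K}

lemma iSupIndep_map_iff {ι R M M' : Type*} [Ring R] [AddCommGroup M] [AddCommGroup M'] [Module R M]
    [Module R M'] {f : M →ₗ[R] M'} (hf : Function.Injective f) {N : ι → Submodule R M} :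
    (iSupIndep fun i => (N i).map f) ↔ iSupIndep N := by
  refine ⟨fun h i => ?_, f.iSupIndep_map hf⟩
  have hi := h i
  simp only [← Submodule.map_iSup] at hi
  exact Submodule.disjoint_def.2 fun x hx hx' => hf <| (Submodule.disjoint_def.1 hi (f x)
    (Submodule.mem_map_of_mem hx) (Submodule.mem_map_of_mem hx')).trans (map_zero f).symm

lemma weight_single_one_apply (m : σ →₀ ℕ) (i : σ) :
    Finsupp.weight (fun i : σ => Finsupp.single i (1 : ℤ)) m i = m i := by
  classical
  induction m using Finsupp.induction_linear with
  | zero => simp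
  | add f g hf hg => simp [hf, hg]
  | single j n => simp [Finsupp.weight_single, Finsupp.single_apply]

lemma weight_single_one_injective :
    Function.Injective (Finsupp.weight (fun i : σ => Finsupp.single i (1 : ℤ)) (R := ℕ)) := by
  intro m m' h
  ext i
  have hi := DFunLike.congr_fun h i
  rw [weight_single_one_apply, weight_single_one_apply] at hi
  exact_mod_cast hi

lemma exists_eq_monomial_of_mem_idealComponent {w : I} {b : σ →₀ ℤ} (hw : w ∈ idealComponent I b)
    (h0 : w ≠ 0) : ∃ u c, c ≠ 0 ∧ (w : MvPolynomial σ K) = monomial u c := by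
  classical
  have hw' : IsWeightedHomogeneous (fun i : σ => Finsupp.single i (1 : ℤ))
      (w : MvPolynomial σ K) b := hw
  obtain ⟨u, hu⟩ := MvPolynomial.ne_zero_iff.1 fun h => h0 (Subtype.ext h)
  refine ⟨u, coeff u (w : MvPolynomial σ K), hu, ?_⟩
  ext m
  rw [coeff_monomial]
  split_ifs with h
  · rw [h]
  · exact by_contra fun hm => h (weight_single_one_injective ((hw' hu).trans (hw' hm).symm))

lemma mem_idealComponent_of_eq_monomial {w : I} (hw : (w : MvPolynomial σ K) = monomial u c) :
    w ∈ idealComponent I (Finsupp.weight (fun i : σ => Finsupp.single i (1 : ℤ)) u) := by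
  change IsWeightedHomogeneous _ (w : MvPolynomial σ K) _
  exact hw ▸ isWeightedHomogeneous_monomial _ _ _ rfl

lemma map_subtype_stanleySpace (hc : c ≠ 0) {w : I} (hw : (w : MvPolynomial σ K) = monomial u c)
    (Z : Finset σ) :
    (stanleySpace (K := K) w Z).map (I.subtype.restrictScalars K) =
      restrictSupport K (box u Z) := by
  rw [box, add_comm, restrictSupport_add, ← toSubmodule_supported,
    restrictSupport_singleton hc.isUnit, ← hw]
  ext p
  rw [Submodule.mem_mul_span_singleton, stanleySpace, ← Submodule.map_comp]
  rfl

lemma isInternal_iff_of_map_subtype_eq {ι : Type*} [DecidableEq ι] {M : Set (σ →₀ ℕ)}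
    (hM : IsUpperSet M) {N : ι → Submodule K (restrictSupportIdeal K M hM)}
    {B : ι → Set (σ →₀ ℕ)}
    (hN : ∀ i, (N i).map ((restrictSupportIdeal K M hM).subtype.restrictScalars K) =
      restrictSupport K (B i)) :
    DirectSum.IsInternal N ↔ ⋃ i, B i = M ∧ Pairwise (Disjoint on B) := by
  set f := (restrictSupportIdeal K M hM).subtype.restrictScalars K
  have hf_inj : Function.Injective f := Subtype.val_injective
  have hf_range : (⊤ : Submodule K _).map f = restrictSupport K M := by
    rw [Submodule.map_top]
    exact SetLike.coe_injective Subtype.range_coe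
  rw [DirectSum.isInternal_submodule_iff_iSupIndep_and_iSup_eq_top, ← iSupIndep_map_iff hf_inj,
    ← (Submodule.map_injective_of_injective hf_inj).eq_iff, Submodule.map_iSup, hf_range]
  simp only [hN, iSupIndep_restrictSupport_iff]
  rw [← restrictSupport_iUnion, restrictSupport_injective.eq_iff, and_comm]

lemma isStanleyDecomposition_iff_isStanleyPartition {M : Set (σ →₀ ℕ)} (hM : IsUpperSet M) {r : ℕ}
    {w : Fin r → restrictSupportIdeal K M hM} {u : Fin r → σ →₀ ℕ} {c : Fin r → K}
    (hc : ∀ i, c i ≠ 0) (hw : ∀ i, (w i : MvPolynomial σ K) = monomial (u i) (c i))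
    (Z : Fin r → Finset σ) :
    IsStanleyDecomposition (K := K) (idealComponent (restrictSupportIdeal K M hM)) w Z ↔
      IsStanleyPartition M u Z := by
  have h := isInternal_iff_of_map_subtype_eq hM
    fun i => map_subtype_stanleySpace (hc i) (hw i) (Z i)
  refine ⟨fun hD => ?_, fun hP => ⟨fun i => ⟨_, mem_idealComponent_of_eq_monomial (hw i)⟩, ?_,
    h.2 ⟨hP.iUnion_eq, hP.pairwise_disjoint⟩⟩⟩
  · obtain ⟨h₁, h₂⟩ := h.1 hD.isInternal
    exact ⟨h₁, h₂⟩
  · intro i f _ hf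
    have hf' : f * monomial (u i) (c i) = 0 := hw i ▸ congrArg Subtype.val hf
    exact (mul_eq_zero.1 hf').resolve_right (monomial_eq_zero.not.2 (hc i))

lemma exists_eq_monomial_of_isStanleyDecomposition {r : ℕ} {w : Fin r → I} {Z : Fin r → Finset σ}
    (h : IsStanleyDecomposition (K := K) (idealComponent I) w Z) (i : Fin r) :
    ∃ u c, c ≠ 0 ∧ (w i : MvPolynomial σ K) = monomial u c := by
  obtain ⟨b, hb⟩ := h.homogeneous i
  refine exists_eq_monomial_of_mem_idealComponent hb fun h0 => ?_
  exact one_ne_zero (h.free i 1 (one_mem _) (by rw [h0, smul_zero]))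

theorem le_idealSdepth_restrictSupportIdeal_iff [Finite σ] {M : Set (σ →₀ ℕ)} (hM : IsUpperSet M)
    {d : ℕ} :
    (d : ℕ∞) ≤ idealSdepth (restrictSupportIdeal K M hM) ↔ HasStanleyPartition M d := by
  constructor
  · intro h
    rcases d with _ | d
    · exact hasStanleyPartition_zero_of_ordConnected hM.ordConnected
    have hd : (d : ℕ∞) < idealSdepth (restrictSupportIdeal K M hM) :=
      (Nat.cast_lt.2 d.lt_succ_self).trans_le h
    simp only [idealSdepth, sdepth, lt_iSup_iff] at hd
    obtain ⟨r, w, Z, hD, hZ⟩ := hd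
    choose u c hc hw using exists_eq_monomial_of_isStanleyDecomposition hD
    refine ⟨r, u, Z, (isStanleyDecomposition_iff_isStanleyPartition hM hc hw Z).1 hD, fun i => ?_⟩
    exact Nat.cast_lt.1 (hZ.trans_le (iInf_le _ i))
  · rintro ⟨r, u, Z, hP, hZ⟩
    let w (i : Fin r) : restrictSupportIdeal K M hM :=
      ⟨monomial (u i) 1, (monomial_mem_restrictSupport K).2 (.inl (hP.subset i (self_mem_box _ _)))⟩
    have hD := (isStanleyDecomposition_iff_isStanleyPartition hM (w := w)
      (fun _ => one_ne_zero) (fun _ => rfl) Z).2 hP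
    exact (le_iInf fun i => Nat.cast_le.2 (hZ i)).trans <|
      le_iSup_of_le r <| le_iSup_of_le w <| le_iSup₂_of_le Z hD le_rfl

lemma idealSdepth_restrictSupportIdeal_le [Finite σ] {M : Set (σ →₀ ℕ)} (hM : IsUpperSet M)
    (hne : M.Nonempty) : idealSdepth (restrictSupportIdeal K M hM) ≤ Nat.card σ := by
  have := Fintype.ofFinite σ
  obtain ⟨m, hm⟩ := hne
  refine ENat.forall_natCast_le_iff_le.1 fun d hd => ?_
  obtain ⟨r, u, Z, hP, hZ⟩ := (le_idealSdepth_restrictSupportIdeal_iff hM).1 hd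
  obtain ⟨i, -⟩ := Set.mem_iUnion.1 (hP.iUnion_eq ▸ hm)
  rw [Nat.card_eq_fintype_card]
  exact_mod_cast (hZ i).trans (Z i).card_le_univ

end MonomialIdeal

section Powers

variable {σ : Type*} {S : Set (σ →₀ ℕ)}

lemma mem_nsmul_iff_exists_multiset {m : σ →₀ ℕ} {k : ℕ} :
    m ∈ k • S ↔ ∃ T : Multiset (σ →₀ ℕ), (∀ s ∈ T, s ∈ S) ∧ T.sum = m ∧ T.card = k := by
  induction k generalizing m with
  | zero => simp [eq_comm]
  | succ k ih =>
    rw [succ_nsmul', Set.mem_add]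
    constructor
    · rintro ⟨s, hs, a, ha, rfl⟩
      obtain ⟨T, hT, rfl, rfl⟩ := ih.1 ha
      exact ⟨s ::ₘ T, Multiset.forall_mem_cons.2 ⟨hs, hT⟩, T.sum_cons s, T.card_cons s⟩
    · rintro ⟨T, hT, rfl, hk⟩
      obtain ⟨s, hs⟩ := Multiset.card_pos_iff_exists_mem.1 (show 0 < T.card by omega)
      obtain ⟨T, rfl⟩ := Multiset.exists_cons_of_mem hs
      obtain ⟨hs, hT⟩ := Multiset.forall_mem_cons.1 hT
      exact ⟨s, hs, T.sum, ih.2 ⟨T, hT, rfl, by simpa using hk⟩, (T.sum_cons s).symm⟩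

lemma le_order_iff_exists_mem_nsmul (hS : 0 ∉ S) {m : σ →₀ ℕ} {k : ℕ} :
    k ≤ order S m ↔ ∃ s ∈ k • S, s ≤ m := by
  simp only [le_order_iff hS, mem_nsmul_iff_exists_multiset]
  constructor
  · rintro ⟨T, hT, hk⟩
    exact ⟨T.sum, ⟨T, hT.1, rfl, hk⟩, hT.2⟩
  · rintro ⟨_, ⟨T, hT, rfl, hk⟩, hm⟩
    exact ⟨T, ⟨hT, hm⟩, hk⟩

lemma span_monomial_image_pow (R : Type*) [CommSemiring R] (S : Set (σ →₀ ℕ)) (k : ℕ) :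
    Ideal.span ((fun s => monomial s (1 : R)) '' S) ^ k =
      Ideal.span ((fun s => monomial s (1 : R)) '' (k • S)) := by
  induction k with
  | zero => simp [Ideal.one_eq_top]
  | succ k ih =>
    rw [pow_succ, ih, Ideal.span_mul_span', succ_nsmul, ← Set.image2_mul, ← Set.image2_add,
      Set.image_image2, Set.image2_image_left, Set.image2_image_right]
    simp only [monomial_mul, mul_one]

lemma isUpperSet_setOf_le_order (hS : 0 ∉ S) (k : ℕ) : IsUpperSet {m | k ≤ order S m} :=
  fun _ _ h hm => le_trans hm (order_mono hS h)

lemma span_monomial_image_pow_eq_restrictSupportIdeal (R : Type*) [CommSemiring R] (hS : 0 ∉ S)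
    (k : ℕ) : Ideal.span ((fun s => monomial s (1 : R)) '' S) ^ k =
      restrictSupportIdeal R {m | k ≤ order S m} (isUpperSet_setOf_le_order hS k) := by
  ext p
  simp only [span_monomial_image_pow, mem_ideal_span_monomial_image,
    ← le_order_iff_exists_mem_nsmul hS]
  rfl

lemma edgeIdeal_eq_span (K : Type*) [Field K] (G : SimpleGraph σ) :
    edgeIdeal K G = Ideal.span ((fun s => monomial s (1 : K)) '' edgeExponents G) := by
  rw [edgeIdeal]
  congr 1
  ext p
  constructor
  · rintro ⟨v, w, h, rfl⟩
    exact ⟨_, ⟨v, w, h, rfl⟩, by simp [X, monomial_mul]⟩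
  · rintro ⟨_, ⟨v, w, h, rfl⟩, rfl⟩
    exact ⟨v, w, h, by simp [X, monomial_mul]⟩

lemma edgeIdeal_pow_eq_restrictSupportIdeal (K : Type*) [Field K] (G : SimpleGraph σ) (k : ℕ) :
    edgeIdeal K G ^ k = restrictSupportIdeal K {m | k ≤ order (edgeExponents G) m}
      (isUpperSet_setOf_le_order (zero_notMem_edgeExponents G) k) := by
  rw [edgeIdeal_eq_span,
    span_monomial_image_pow_eq_restrictSupportIdeal K (zero_notMem_edgeExponents G)]

lemma truncLevel_univ_self (ν : (σ →₀ ℕ) → ℕ) (k : ℕ) :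
    truncLevel ν Set.univ k k = {m | k ≤ ν m} := by
  ext m
  simp [truncLevel]

lemma le_idealSdepth_edgeIdeal_pow_iff [Finite σ] {K : Type*} [Field K] {G : SimpleGraph σ}
    {k d : ℕ} :
    (d : ℕ∞) ≤ idealSdepth (edgeIdeal K G ^ k) ↔
      HasStanleyPartition (truncLevel (order (edgeExponents G)) Set.univ k k) d := by
  rw [edgeIdeal_pow_eq_restrictSupportIdeal, le_idealSdepth_restrictSupportIdeal_iff,
    truncLevel_univ_self]

lemma idealSdepth_edgeIdeal_pow_le [Finite σ] {K : Type*} [Field K] {G : SimpleGraph σ}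
    (hG : G.edgeSet.Nonempty) (k : ℕ) : idealSdepth (edgeIdeal K G ^ k) ≤ Nat.card σ := by
  rw [edgeIdeal_pow_eq_restrictSupportIdeal]
  refine idealSdepth_restrictSupportIdeal_le _ ?_
  obtain ⟨⟨v, w⟩, hvw : G.Adj v w⟩ := hG
  let s : σ →₀ ℕ := Finsupp.single v 1 + Finsupp.single w 1
  refine ⟨k • s, (le_order_iff (zero_notMem_edgeExponents G)).2
    ⟨Multiset.replicate k s, ⟨fun t ht => ?_, by simp⟩, Multiset.card_replicate k s⟩⟩
  exact Multiset.eq_of_mem_replicate ht ▸ ⟨v, w, hvw, rfl⟩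

lemma hasStanleyPartition_truncLevel_zero (ν : (σ →₀ ℕ) → ℕ) (A : Set σ) [Finite A] :
    HasStanleyPartition (truncLevel ν A 0 0) (Nat.card A) := by
  simpa [truncLevel] using hasStanleyPartition_supported A

lemma hasStanleyPartition_truncLevel_of_le_iInf [Finite σ] {K : Type*} [Field K]
    {G : SimpleGraph σ} {A : Set σ} {k l d : ℕ} (hd : d ≤ Nat.card A)
    (h : (d : ℕ∞) ≤ ⨅ l ∈ Finset.Icc 1 k, idealSdepth (edgeIdeal K (G.induce A) ^ l))
    (hl : l ≤ k) : HasStanleyPartition (truncLevel (order (edgeExponents G)) A l l) d := by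
  rcases l.eq_zero_or_pos with rfl | hl0
  · exact (hasStanleyPartition_truncLevel_zero _ A).mono hd
  · exact hasStanleyPartition_truncLevel_of_induce <| le_idealSdepth_edgeIdeal_pow_iff.1 <|
      h.trans (iInf₂_le l (Finset.mem_Icc.2 ⟨hl0, hl⟩))

end Powers

end StanleyDepth

open StanleyDepth in
theorem theorem3p1_general {V K : Type*} [Finite V] [Field K] (G : SimpleGraph V) {A : Set V}
    (hA : ∀ v ∈ A, ∀ w ∉ A, ¬ G.Adj v w) (hE : (G.induce A).edgeSet.Nonempty) {k : ℕ}
    (hk : 1 ≤ k) :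
    (⨅ l ∈ Finset.Icc 1 k, idealSdepth (edgeIdeal K (G.induce A) ^ l)) +
      (numBipartiteComponents (G.induce Aᶜ) : ℕ∞) ≤ idealSdepth (edgeIdeal K G ^ k) := by
  have hle : ⨅ l ∈ Finset.Icc 1 k, idealSdepth (edgeIdeal K (G.induce A) ^ l) ≤ Nat.card A :=
    (iInf₂_le k (Finset.mem_Icc.2 ⟨hk, le_rfl⟩)).trans (idealSdepth_edgeIdeal_pow_le hE k)
  obtain ⟨d, hd⟩ := ENat.ne_top_iff_exists.1 (hle.trans_lt (ENat.natCast_lt_top _)).ne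
  have hdA : d ≤ Nat.card A := Nat.cast_le.1 (hd ▸ hle)
  rw [← hd, add_comm, ← Nat.cast_add, le_idealSdepth_edgeIdeal_pow_iff, ← Set.compl_union_self A]
  refine hasStanleyPartition_truncLevel_union disjoint_compl_left
    (fun _ ha _ hb => order_edgeExponents_add disjoint_compl_left
      (fun v hv w hw hvw => hA w hw v hv hvw.symm) ha hb)
    (fun i _ => ?_) fun i _ => ?_
  · exact hasStanleyPartition_truncLevel_of_induce
      (powersHaveDepth_numBipartiteComponents (G.induce Aᶜ) k i)
  · exact hasStanleyPartition_truncLevel_of_le_iInf hdA hd.le (Nat.sub_le k i)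

theorem theorem3p1 {V K : Type*} [Finite V] [Field K] (G : SimpleGraph V)
    (H : G.ConnectedComponent) (hH : H.toSimpleGraph.edgeSet.Nonempty) (k : ℕ) (hk : 1 ≤ k) :
    (⨅ l ∈ Finset.Icc 1 k,
        StanleyDepth.idealSdepth (StanleyDepth.edgeIdeal K H.toSimpleGraph ^ l)) +
      (StanleyDepth.numBipartiteComponents (G.induce H.suppᶜ) : ℕ∞) ≤
    StanleyDepth.idealSdepth (StanleyDepth.edgeIdeal K G ^ k) :=
  theorem3p1_general G (A := H.supp)
    (fun _ hv _ hw hvw => hw (H.mem_supp_of_adj_mem_supp hv hvw)) hH hk
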